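/- **Setting.** Let $T=(S_T,s_0,E_T,\Pi,L_T,w_T,\mathcal O_T)$ be a finite weighted transition system: $s_0\in S_T$, $E_T\subseteq S_T\times S_T$, $L_T:S_T\to 2^{\Pi}$, $w_T:E_T\to\mathbb N_{>0}$, and a set $\mathcal O_T$ of obstacle cells, where $s_0\notin\mathcal O_T$ and no transition touches $\mathcal O_T$. Let $\phi$ be an LTL formula over $\Pi$ (built from true, atoms, $\wedge$, $\neg$, $X$, $U$, interpreted over infinite words in $2^\Pi$). Let $B=(Q_B,q_0,\delta_B,Q_f)$ be a finite Büchi automaton that accepts exactly the words satisfying $\phi$. Its transitions $q\xrightarrow{c}q'$ carry Boolean conditions $c$ over $\Pi$, and a letter $A\in 2^\Pi$ enables such a transition iff $A\models c$; write $s\models c$ for $L_T(s)\models c$. A condition is *negative* if it is a conjunction of (one or more) negated atomic propositions, and *positive* otherwise. A state $q$ is *distant* if it has a self-loop with a negative condition and no negative transition from $q$ leads to a state other than $q$. **Reduced graph.** Fix an initial vertex $v_0=(s_0,q)$ with $q\in Q_B$; the choice of T\* is $q=q_0$. From a vertex $(s_i,q_i)$ there are the following edges. If $q_i$ is distant: an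 edge to every $(s_j,q_j)$, with $s_j$ any cell, such that $q_i\xrightarrow{c}q_j$ and $s_j\models c$ for some positive $c$. If $q_i$ is not distant: an edge to every $(s_j,q_j)$ such that $(s_i,s_j)\in E_T$ and $q_i\xrightarrow{c}q_j$, $s_j\models c$ for some $c$ (product edges). The vertices of $G_r$ are those reachable from $v_0$, and a vertex is final if its automaton component lies in $Q_f$. Edges leaving distant states first have heuristic weight $h(s_i,s_j)$ (for an arbitrary $h:S_T\times S_T\to\mathbb N$) and are marked "not updated". All other edges have weight $w_T(s_i,s_j)$ and are marked "updated". **Algorithm T\*.** *Updating* a not yet updated edge $(s_i,q_i)\to(s_j,q_j)$ means: choose a negative self-loop condition $c_{neg}$ of $q_i$; let A\* find a least-cost path of $T$ from $s_i$ to $s_j$, with at least one transition, whose intermediate cells avoid $\mathcal O_T\cup\{s: s\not\models c_{neg}\}$; make its cost ($\infty$ if there is no such path) the weight of the edge, store the path, and mark the edge updated. For each final vertex $f$ of $G_r$, in any order: 1. Repeat: let Dijkstra's algorithm find a finite-cost closed path $f\to f$ (at least one edge) of least current cost in $G_r$, and update its not yet updated edges; until no edge had to be updated (the path is then the suffix for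 $f$) or no closed path of finite cost is left (there is no suffix for $f$). 2. Let Dijkstra's algorithm find a least-cost path $v_0\to f$ and update its edges once. It is a valid prefix for $f$ if its cost is finite afterwards. Among all $f$ with a suffix and a valid prefix, choose one whose suffix has least cost. Project the prefix and the suffix to $T$, replacing every distant edge by its stored A\* path. This yields finite sequences of cells $\mathcal R^{pre}$ (which begins with $s_0$) and $\mathcal R^{suf}$, and the output $\mathcal R=\mathcal R^{pre}\cdot(\mathcal R^{suf})^\omega$. **Theorem.** Let $\mathcal R=s_0,s_1,s_2,\dots$ be any output of T\*, with trace $\pi_n=L_T(s_n)$. Then $\mathcal R^{suf}$ is nonempty, and $\mathcal R$ is an infinite run of $T$: it starts at $s_0$, $(s_n,s_{n+1})\in E_T$ for all $n$, and it never visits $\mathcal O_T$. It satisfies $\phi$ in the following sense. (a) If the initial vertex is $v_0=(s_0,q_0)$, so that the automaton reads the label of each cell the robot enters and does not read the label of $s_0$, then $\pi_1\pi_2\pi_3\cdots\models\phi$. If moreover putting $L_T(s_0)$ in front of a word never destroys $\phi$ (that is, $\sigma\models\phi$ implies $L_T(s_0)\,\sigma\models\phi$ for every infinite word $\sigma$),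 then $\pi_0\pi_1\pi_2\cdots\models\phi$. (b) If the initial vertex is $v_0=(s_0,q)$ where $q$ is reached from $q_0$ by reading $L_T(s_0)$ (some transition $q_0\xrightarrow{c}q$ has $s_0\models c$), then $\pi_0\pi_1\pi_2\cdots\models\phi$. -/

import Mathlib

namespace TStar

/-! ### Linear temporal logic over infinite words of sets of atomic propositions -/

inductive LTL (AP : Type*) where
  | tru : LTL AP
  | atom (a : AP) : LTL AP
  | and (φ ψ : LTL AP) : LTL AP
  | not (φ : LTL AP) : LTL AP
  | next (φ : LTL AP) : LTL AP
  | until (φ ψ : LTL AP) : LTL AP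

/-- `φ.SatAt σ i`: the formula `φ` holds at position `i` of the infinite word `σ`. -/
def LTL.SatAt {AP : Type*} (σ : ℕ → Set AP) : LTL AP → ℕ → Prop
  | .tru, _ => True
  | .atom a, i => a ∈ σ i
  | .and φ ψ, i => LTL.SatAt σ φ i ∧ LTL.SatAt σ ψ i
  | .not φ, i => ¬ LTL.SatAt σ φ i
  | .next φ, i => LTL.SatAt σ φ (i + 1)
  | .until φ ψ, i => ∃ k, i ≤ k ∧ LTL.SatAt σ ψ k ∧ ∀ j, i ≤ j → j < k → LTL.SatAt σ φ j

/-- A word satisfies a formula if its first position does. -/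
def LTL.Sat {AP : Type*} (σ : ℕ → Set AP) (φ : LTL AP) : Prop := LTL.SatAt σ φ 0

/-! ### Weighted transition systems -/

/-- A weighted transition system with states `S`, atomic propositions `AP`, positive integer
weights on its transitions, and a set of obstacle cells which the robot never occupies. -/
structure TransitionSystem (S AP : Type*) where
  init : S
  E : S → S → Prop
  L : S → Set AP
  w : S → S → ℕ
  w_pos : ∀ s t, E s t → 0 < w s t
  obs : Set S
  init_free : init ∉ obs
  E_free : ∀ s t, E s t → s ∉ obs ∧ t ∉ obs

/-- An infinite run over the transition system: a trajectory of the robot. -/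
def TransitionSystem.IsRun {S AP : Type*} (T : TransitionSystem S AP) (ρ : ℕ → S) : Prop :=
  ρ 0 = T.init ∧ ∀ n, T.E (ρ n) (ρ (n + 1))

/-- The trace of sets of atomic propositions of a trajectory. -/
def TransitionSystem.trace {S AP : Type*} (T : TransitionSystem S AP) (ρ : ℕ → S) : ℕ → Set AP :=
  fun n => T.L (ρ n)

/-! ### Transition conditions and Büchi automata -/

/-- Transition conditions: Boolean combinations of atomic propositions. -/
inductive Cond (AP : Type*) where
  | tru : Cond AP
  | atom (a : AP) : Cond AP
  | not (c : Cond AP) : Cond AP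
  | and (c d : Cond AP) : Cond AP
  | or (c d : Cond AP) : Cond AP

def Cond.Holds {AP : Type*} (A : Set AP) : Cond AP → Prop
  | .tru => True
  | .atom a => a ∈ A
  | .not c => ¬ Cond.Holds A c
  | .and c d => Cond.Holds A c ∧ Cond.Holds A d
  | .or c d => Cond.Holds A c ∨ Cond.Holds A d

/-- A condition is negative if it is a conjunction of negated atomic propositions. All other
conditions are positive. -/
def Cond.IsNegative {AP : Type*} : Cond AP → Prop
  | .not (.atom _) => True
  | .and c d => Cond.IsNegative c ∧ Cond.IsNegative d
  | _ => False

/-- A (nondeterministic) Büchi automaton over the alphabet `Set AP`, whose transitions are given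
by transition conditions. -/
structure Buchi (Q AP : Type*) where
  init : Q
  trans : Set (Q × Cond AP × Q)
  final : Set Q

/-- The transition relation on letters: the letter `A` leads from `q` to `q'` if it satisfies
the condition of a transition from `q` to `q'`. -/
def Buchi.Step {Q AP : Type*} (B : Buchi Q AP) (q : Q) (A : Set AP) (q' : Q) : Prop :=
  ∃ c, (q, c, q') ∈ B.trans ∧ c.Holds A

/-- Büchi acceptance: some run on the word visits the final states infinitely often. -/
def Buchi.Accepts {Q AP : Type*} (B : Buchi Q AP) (σ : ℕ → Set AP) : Prop :=
  ∃ r : ℕ → Q, r 0 = B.init ∧ (∀ n, B.Step (r n) (σ n) (r (n + 1))) ∧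
    ∀ n, ∃ m, n ≤ m ∧ r m ∈ B.final

/-- `B` is a Büchi automaton for the formula `φ`. -/
def Buchi.Recognizes {Q AP : Type*} (B : Buchi Q AP) (φ : LTL AP) : Prop :=
  ∀ σ : ℕ → Set AP, B.Accepts σ ↔ LTL.Sat σ φ

/-- There is a self-loop on `q` with a negative transition condition. -/
def Buchi.NegLoop {Q AP : Type*} (B : Buchi Q AP) (q : Q) : Prop :=
  ∃ c, c.IsNegative ∧ (q, c, q) ∈ B.trans

/-- The distant neighbour condition at `q`: there is a negative self-loop on `q`, and no negative
transition from `q` to another state. -/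
def Buchi.Distant {Q AP : Type*} (B : Buchi Q AP) (q : Q) : Prop :=
  B.NegLoop q ∧ ¬ ∃ c q', c.IsNegative ∧ q' ≠ q ∧ (q, c, q') ∈ B.trans

/-! ### The reduced graph -/

/-- The edges of the reduced graph. At a state with the distant neighbour condition the edges
follow the positive transitions, to all cells satisfying their condition; at all other states
they are the edges of the product automaton. -/
def RedEdge {S AP Q : Type*} (T : TransitionSystem S AP) (B : Buchi Q AP) (v v' : S × Q) : Prop :=
  (B.Distant v.2 ∧ ∃ c, ¬ c.IsNegative ∧ (v.2, c, v'.2) ∈ B.trans ∧ c.Holds (T.L v'.1)) ∨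
  (¬ B.Distant v.2 ∧ T.E v.1 v'.1 ∧ ∃ c, (v.2, c, v'.2) ∈ B.trans ∧ c.Holds (T.L v'.1))

/-- The vertices of the reduced graph: those which breadth-first search from `v₀` discovers. -/
def RedVert {S AP Q : Type*} (T : TransitionSystem S AP) (B : Buchi Q AP) (v₀ : S × Q) :
    Set (S × Q) :=
  {v | Relation.ReflTransGen (RedEdge T B) v₀ v}

/-- The final vertices of the reduced graph. -/
def RedFinal {S AP Q : Type*} (T : TransitionSystem S AP) (B : Buchi Q AP) (v₀ : S × Q) :
    Set (S × Q) :=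
  {v | v ∈ RedVert T B v₀ ∧ v.2 ∈ B.final}

/-- The data which the algorithm keeps on the edges of the reduced graph: the current weight
(`⊤` if the search found no path), whether the weight is an actual cost, and, if it is, the cells
which the robot enters one after the other when it follows the edge. -/
structure EdgeData (S Q : Type*) where
  wt : (S × Q) × (S × Q) → ℕ∞
  updated : (S × Q) × (S × Q) → Prop
  path : (S × Q) × (S × Q) → List S

open Classical in
/-- Edge data of the newly generated reduced graph: heuristic cost on edges to distant
neighbours, actual cost on all other edges. -/
noncomputable def initData {S AP Q : Type*} (T : TransitionSystem S AP) (B : Buchi Q AP)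
    (h : S → S → ℕ) : EdgeData S Q where
  wt e := if B.Distant e.1.2 then (h e.1.1 e.2.1 : ℕ∞) else (T.w e.1.1 e.2.1 : ℕ∞)
  updated e := ¬ B.Distant e.1.2
  path e := if B.Distant e.1.2 then [] else [e.2.1]

open Classical in
/-- Record the actual weight `d` and the path `p` for the edge `e`. -/
noncomputable def EdgeData.set {S Q : Type*} (g : EdgeData S Q) (e : (S × Q) × (S × Q)) (d : ℕ∞)
    (p : List S) : EdgeData S Q where
  wt e' := if e' = e then d else g.wt e'
  updated e' := e' = e ∨ g.updated e'
  path e' := if e' = e then p else g.path e'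

/-! ### Paths in the two graphs

A path from `x` is given by the list `l` of the nodes which follow `x` on it. -/

/-- The consecutive pairs (edges) of the path `x :: l`. -/
def edges {V : Type*} (x : V) (l : List V) : List (V × V) := (x :: l).zip l

/-- `x :: l` is a path from `x` to `y` along the relation `E`. -/
def IsPath {V : Type*} (E : V → V → Prop) (x : V) (l : List V) (y : V) : Prop :=
  (∀ e ∈ edges x l, E e.1 e.2) ∧ (x :: l).getLast? = some y

/-- Current cost of a path in the reduced graph. -/
noncomputable def EdgeData.cost {S Q : Type*} (g : EdgeData S Q) (x : S × Q) (l : List (S × Q)) :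
    ℕ∞ :=
  ((edges x l).map g.wt).sum

/-- Cost of a path in the transition system. -/
def TransitionSystem.cost {S AP : Type*} (T : TransitionSystem S AP) (x : S) (l : List S) : ℕ :=
  ((edges x l).map fun e => T.w e.1 e.2).sum

/-- A path (with at least one transition) from `s` to `t` in the transition system, all of whose
intermediate cells lie outside `O`. -/
def AvoidPath {S AP : Type*} (T : TransitionSystem S AP) (O : Set S) (s t : S) (l : List S) :
    Prop :=
  l ≠ [] ∧ IsPath T.E s l t ∧ ∀ x ∈ l.dropLast, x ∉ O

/-- A result of the A* search from `s` to `t` with obstacles `O`: a least-cost path. -/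
def AStar {S AP : Type*} (T : TransitionSystem S AP) (O : Set S) (s t : S) (l : List S) : Prop :=
  AvoidPath T O s t l ∧ ∀ l', AvoidPath T O s t l' → T.cost s l ≤ T.cost s l'

/-- The obstacles for a search under the negative self-loop condition `c`: the obstacle cells and
the cells that violate `c`. -/
def obstacles {S AP : Type*} (T : TransitionSystem S AP) (c : Cond AP) : Set S :=
  T.obs ∪ {s | ¬ c.Holds (T.L s)}

/-- A result of Dijkstra's algorithm for a closed path from `f` to `f` (with at least one edge)
in the reduced graph: one of least cost, this cost being finite. -/
def MinCycle {S AP Q : Type*} (T : TransitionSystem S AP) (B : Buchi Q AP) (g : EdgeData S Q)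
    (f : S × Q) (l : List (S × Q)) : Prop :=
  l ≠ [] ∧ IsPath (RedEdge T B) f l f ∧ g.cost f l < ⊤ ∧
    ∀ l', l' ≠ [] → IsPath (RedEdge T B) f l' f → g.cost f l ≤ g.cost f l'

/-- A result of Dijkstra's algorithm for a path from `v` to `f` in the reduced graph. -/
def MinPath {S AP Q : Type*} (T : TransitionSystem S AP) (B : Buchi Q AP) (g : EdgeData S Q)
    (v f : S × Q) (l : List (S × Q)) : Prop :=
  IsPath (RedEdge T B) v l f ∧ g.cost v l < ⊤ ∧
    ∀ l', IsPath (RedEdge T B) v l' f → g.cost v l ≤ g.cost v l'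

/-! ### The algorithm, as a big-step semantics

The steps are nondeterministic where the pseudocode leaves a choice: ties between least-cost paths,
the negative self-loop used if there are several, and the order of the final vertices. -/

/-- `UpdateEdges T B g es g' n`: updating the edges `es` one after the other turns the edge data
`g` into `g'`, and `n` edges are updated. -/
inductive UpdateEdges {S AP Q : Type*} (T : TransitionSystem S AP) (B : Buchi Q AP) :
    EdgeData S Q → List ((S × Q) × (S × Q)) → EdgeData S Q → ℕ → Prop where
  | nil (g) : UpdateEdges T B g [] g 0
  | skip {g e es g' n} (he : ¬ (B.NegLoop e.1.2 ∧ ¬ g.updated e))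
      (hr : UpdateEdges T B g es g' n) : UpdateEdges T B g (e :: es) g' n
  | found {g e es g' n} (c : Cond AP) (p : List S) (hc : c.IsNegative)
      (hl : (e.1.2, c, e.1.2) ∈ B.trans) (he : ¬ g.updated e)
      (hp : AStar T (obstacles T c) e.1.1 e.2.1 p)
      (hr : UpdateEdges T B (g.set e (T.cost e.1.1 p : ℕ∞) p) es g' n) :
      UpdateEdges T B g (e :: es) g' (n + 1)
  | blocked {g e es g' n} (c : Cond AP) (hc : c.IsNegative)
      (hl : (e.1.2, c, e.1.2) ∈ B.trans) (he : ¬ g.updated e)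
      (hp : ¬ ∃ p, AvoidPath T (obstacles T c) e.1.1 e.2.1 p)
      (hr : UpdateEdges T B (g.set e ⊤ []) es g' n) :
      UpdateEdges T B g (e :: es) g' (n + 1)

/-- The inner loop for the final vertex `f`: repeat Dijkstra's algorithm and the update of the
edges of the cycle found, until no edge is updated or no cycle of finite cost is left. -/
inductive SuffixSearch {S AP Q : Type*} (T : TransitionSystem S AP) (B : Buchi Q AP) (f : S × Q) :
    EdgeData S Q → EdgeData S Q → Option (List (S × Q)) → Prop where
  | fail {g} (hn : ¬ ∃ l, MinCycle T B g f l) : SuffixSearch T B f g g none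
  | done {g g' l} (hl : MinCycle T B g f l) (hu : UpdateEdges T B g (edges f l) g' 0) :
      SuffixSearch T B f g g' (some l)
  | again {g g₁ g' l n r} (hl : MinCycle T B g f l)
      (hu : UpdateEdges T B g (edges f l) g₁ (n + 1)) (hr : SuffixSearch T B f g₁ g' r) :
      SuffixSearch T B f g g' r

/-- The search for a prefix: Dijkstra's algorithm and one update of the edges of the path found.
The prefix is valid if its cost is finite after the update. -/
inductive PrefixSearch {S AP Q : Type*} (T : TransitionSystem S AP) (B : Buchi Q AP)
    (v₀ f : S × Q) : EdgeData S Q → EdgeData S Q → Option (List (S × Q)) → Prop where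
  | fail {g} (hn : ¬ ∃ l, MinPath T B g v₀ f l) : PrefixSearch T B v₀ f g g none
  | valid {g g' l n} (hl : MinPath T B g v₀ f l) (hu : UpdateEdges T B g (edges v₀ l) g' n)
      (hv : g'.cost v₀ l < ⊤) : PrefixSearch T B v₀ f g g' (some l)
  | invalid {g g' l n} (hl : MinPath T B g v₀ f l) (hu : UpdateEdges T B g (edges v₀ l) g' n)
      (hv : ¬ g'.cost v₀ l < ⊤) : PrefixSearch T B v₀ f g g' none

/-- The outer loop over the final vertices. It collects the triples of a final vertex, its suffix
and its valid prefix. -/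
inductive MainLoop {S AP Q : Type*} (T : TransitionSystem S AP) (B : Buchi Q AP) (v₀ : S × Q) :
    EdgeData S Q → List (S × Q) → EdgeData S Q →
      List ((S × Q) × List (S × Q) × List (S × Q)) → Prop where
  | nil (g) : MainLoop T B v₀ g [] g []
  | keep {g g₁ g₂ g' f fs l p rs} (hs : SuffixSearch T B f g g₁ (some l))
      (hp : PrefixSearch T B v₀ f g₁ g₂ (some p)) (hr : MainLoop T B v₀ g₂ fs g' rs) :
      MainLoop T B v₀ g (f :: fs) g' ((f, l, p) :: rs)
  | drop {g g₁ g₂ g' f fs o o' rs} (hs : SuffixSearch T B f g g₁ o)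
      (hp : PrefixSearch T B v₀ f g₁ g₂ o') (ho : o = none ∨ o' = none)
      (hr : MainLoop T B v₀ g₂ fs g' rs) : MainLoop T B v₀ g (f :: fs) g' rs

/-- Projection of a path of the reduced graph to the transition system, every edge being replaced
by the cells which the robot enters when it follows the edge. -/
def EdgeData.project {S Q : Type*} (g : EdgeData S Q) (x : S × Q) (l : List (S × Q)) : List S :=
  (edges x l).flatMap g.path

/-- `Output T B h v₀ pre suf`: with the heuristic `h` and the initial vertex `v₀`, T* can output
the run `pre · suf^ω`. -/
def Output {S AP Q : Type*} (T : TransitionSystem S AP) (B : Buchi Q AP) (h : S → S → ℕ)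
    (v₀ : S × Q) (pre suf : List S) : Prop :=
  ∃ (fs : List (S × Q)) (g : EdgeData S Q) (rs : List ((S × Q) × List (S × Q) × List (S × Q))),
    fs.Nodup ∧ (∀ f, f ∈ fs ↔ f ∈ RedFinal T B v₀) ∧
    MainLoop T B v₀ (initData T B h) fs g rs ∧
    ∃ r ∈ rs, (∀ r' ∈ rs, g.cost r.1 r.2.1 ≤ g.cost r'.1 r'.2.1) ∧
      pre = v₀.1 :: g.project v₀ r.2.2 ∧ suf = g.project r.1 r.2.1

/-- The infinite sequence `pre · suf^ω` (for `suf ≠ []`; the value `d` is then never used). -/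
def lasso {S : Type*} (d : S) (pre suf : List S) (n : ℕ) : S :=
  if n < pre.length then pre.getD n d else suf.getD ((n - pre.length) % suf.length) d

/-- The infinite word `A · σ`. -/
def consWord {AP : Type*} (A : Set AP) (σ : ℕ → Set AP) : ℕ → Set AP
  | 0 => A
  | n + 1 => σ n

end TStar

namespace TStar

/-! ### Paths and lassos -/

section Paths

variable {V : Type*} {E : V → V → Prop}

/-! Every output is the projection of a lasso in the product of `T` and `B` whose cycle passes
through a final vertex (`Output.exists_prod_lasso`); its second components form an accepting run.
The key point is that a distant edge stands for a product path: the automaton waits in its negative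
self-loop on the intermediate cells of the A* path and takes the positive transition on entering the
target (`exists_prod_path_of_self_loop`). The algorithm maintains that updated edges of finite
weight store such paths (`Sound`) and that updated edges are never overwritten (`Extends`), so paths
found early are still valid in the final data. Suffix and prefix consist of updated edges and have
finite cost, hence lift to the product. The automaton reads the cell entered, so the run reads the
trace from index 1; in case (b) one more step is put in front. -/

theorem isPath_nil {x y : V} : IsPath E x [] y ↔ x = y := by
  simp [IsPath, edges]

theorem isPath_cons {x a y : V} {l : List V} :
    IsPath E x (a :: l) y ↔ E x a ∧ IsPath E a l y := by
  simp [IsPath, edges, and_assoc]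

theorem IsPath.append {y z : V} {l₂ : List V} (h₂ : IsPath E y l₂ z) :
    ∀ {x : V} {l₁ : List V}, IsPath E x l₁ y → IsPath E x (l₁ ++ l₂) z
  | x, [], h₁ => by
    rw [isPath_nil] at h₁
    subst h₁
    exact h₂
  | x, a :: l₁, h₁ => by
    rw [isPath_cons] at h₁
    exact isPath_cons.2 ⟨h₁.1, h₂.append h₁.2⟩

theorem IsPath.rel_getD (d : V) {y : V} :
    ∀ {x : V} {l : List V}, IsPath E x l y → ∀ i < l.length, E ((x :: l).getD i d) (l.getD i d)
  | x, [], _, i, hi => by simp at hi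
  | x, a :: l, h, 0, _ => by simpa using (isPath_cons.1 h).1
  | x, a :: l, h, i + 1, hi => by
    simpa using (isPath_cons.1 h).2.rel_getD d i (by simpa using hi)

theorem IsPath.getD_length (d : V) {y : V} :
    ∀ {x : V} {l : List V}, IsPath E x l y → (x :: l).getD l.length d = y
  | x, [], h => by simpa using isPath_nil.1 h
  | x, a :: l, h => by simpa using (isPath_cons.1 h).2.getD_length d

/-- The last entry of `C` is `y`, so read cyclically `C` is `y :: C` without its last entry, shifted
by one; only the wraparound needs the closing of the path. -/
theorem IsPath.getD_mod_succ (d : V) {y : V} {C : List V} (hC : IsPath E y C y) (hne : C ≠ [])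
    (k : ℕ) : C.getD (k % C.length) d = (y :: C).getD ((k + 1) % C.length) d := by
  have hpos : 0 < C.length := List.length_pos_iff.2 hne
  have hlt := Nat.mod_lt k hpos
  rcases Nat.lt_or_ge (k % C.length + 1) C.length with h | h
  · have : (k + 1) % C.length = k % C.length + 1 := by
      rw [← Nat.mod_add_mod, Nat.mod_eq_of_lt h]
    rw [this, List.getD_cons_succ]
  · have h' : k % C.length + 1 = C.length := by omega
    have : (k + 1) % C.length = 0 := by
      rw [← Nat.mod_add_mod, h', Nat.mod_self]
    rw [this, List.getD_cons_zero, ← List.getD_cons_succ (x := y), h']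
    exact hC.getD_length d

theorem lasso_zero (d x : V) (P C : List V) : lasso d (x :: P) C 0 = x := by
  simp [lasso]

/-- Counting starts at the last entry of `x :: P`, which is `y`, so the junction looks like any
other return to `y`. -/
theorem lasso_prefix_length_add (d : V) {x y : V} {P C : List V} (hP : IsPath E x P y)
    (hC : IsPath E y C y) (hne : C ≠ []) (k : ℕ) :
    lasso d (x :: P) C (P.length + k) = (y :: C).getD (k % C.length) d := by
  cases k with
  | zero => simpa [lasso] using hP.getD_length d
  | succ k =>
    rw [← hC.getD_mod_succ d hne, lasso, if_neg (by simp)]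
    congr 2
    simp only [List.length_cons]
    omega

theorem lasso_rel (d : V) {x y : V} {P C : List V} (hP : IsPath E x P y)
    (hC : IsPath E y C y) (hne : C ≠ []) (n : ℕ) :
    E (lasso d (x :: P) C n) (lasso d (x :: P) C (n + 1)) := by
  rcases Nat.lt_or_ge n P.length with h | h
  · rw [lasso, lasso, if_pos (by simp; omega), if_pos (by simpa using h), List.getD_cons_succ]
    exact hP.rel_getD d n h
  · obtain ⟨k, rfl⟩ := Nat.exists_eq_add_of_le h
    rw [Nat.add_assoc, lasso_prefix_length_add d hP hC hne, lasso_prefix_length_add d hP hC hne,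
      ← hC.getD_mod_succ d hne]
    exact hC.rel_getD d _ (Nat.mod_lt _ (List.length_pos_iff.2 hne))

theorem lasso_prefix_length_add_mul (d : V) {x y : V} {P C : List V} (hP : IsPath E x P y)
    (hC : IsPath E y C y) (hne : C ≠ []) (k : ℕ) :
    lasso d (x :: P) C (P.length + k * C.length) = y := by
  rw [lasso_prefix_length_add d hP hC hne, Nat.mul_mod_left, List.getD_cons_zero]

theorem map_lasso {W : Type*} (f : V → W) (d : V) (P C : List V) (n : ℕ) :
    f (lasso d P C n) = lasso (f d) (P.map f) (C.map f) n := by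
  simp only [lasso, List.length_map, List.getD_map]
  split_ifs <;> rfl

end Paths

section Algorithm

variable {S AP Q : Type*} {T : TransitionSystem S AP} {B : Buchi Q AP}

/-! ### The product of the transition system and the automaton -/

/-- The edges of the product automaton: the automaton reads the label of the cell entered. -/
def ProdEdge (T : TransitionSystem S AP) (B : Buchi Q AP) (v v' : S × Q) : Prop :=
  T.E v.1 v'.1 ∧ B.Step v.2 (T.L v'.1) v'.2

/-- The path stored for the edge `e` is the projection of a nonempty product path along `e`. -/
def Realized (T : TransitionSystem S AP) (B : Buchi Q AP) (g : EdgeData S Q)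
    (e : (S × Q) × (S × Q)) : Prop :=
  ∃ l, l ≠ [] ∧ IsPath (ProdEdge T B) e.1 l e.2 ∧ l.map Prod.fst = g.path e

theorem exists_prod_path_of_self_loop {q q' : Q} {t : S} (ht : B.Step q (T.L t) q') :
    ∀ {s : S} {p : List S}, p ≠ [] → IsPath T.E s p t →
      (∀ x ∈ p.dropLast, B.Step q (T.L x) q) →
      ∃ l, l ≠ [] ∧ IsPath (ProdEdge T B) (s, q) l (t, q') ∧ l.map Prod.fst = p
  | s, [], hne, _, _ => absurd rfl hne
  | s, [a], _, hp, _ => by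
    obtain ⟨hE, ha⟩ := isPath_cons.1 hp
    rw [isPath_nil] at ha
    subst ha
    exact ⟨[(a, q')], by simp, isPath_cons.2 ⟨⟨hE, ht⟩, isPath_nil.2 rfl⟩, rfl⟩
  | s, a :: b :: p, _, hp, hq => by
    obtain ⟨hE, hp⟩ := isPath_cons.1 hp
    obtain ⟨l, -, hl, hm⟩ := exists_prod_path_of_self_loop ht (by simp) hp
      fun x hx => hq x (by simp [hx])
    exact ⟨(a, q) :: l, by simp, isPath_cons.2 ⟨⟨hE, hq a (by simp)⟩, hl⟩, by simp [hm]⟩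

/-- Concatenate the lifts of the edges. Each lift is nonempty, which in the end makes the suffix
nonempty. -/
theorem exists_prod_path_of_realized {g : EdgeData S Q} {y : S × Q} :
    ∀ {x : S × Q} {l : List (S × Q)}, IsPath (RedEdge T B) x l y →
      (∀ e ∈ edges x l, Realized T B g e) →
      ∃ l', IsPath (ProdEdge T B) x l' y ∧ l'.map Prod.fst = g.project x l ∧ (l ≠ [] → l' ≠ [])
  | x, [], h, _ => ⟨[], isPath_nil.2 (isPath_nil.1 h), by simp [EdgeData.project, edges], by simp⟩
  | x, a :: l, h, hr => by
    obtain ⟨l₂, h₂, hm₂, -⟩ := exists_prod_path_of_realized (isPath_cons.1 h).2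
      fun e he => hr e (List.mem_cons_of_mem _ he)
    obtain ⟨l₁, hne, h₁, hm₁⟩ := hr (x, a) List.mem_cons_self
    refine ⟨l₁ ++ l₂, IsPath.append h₂ h₁, ?_, fun _ => by simp [hne]⟩
    rw [List.map_append, hm₁, hm₂]
    rfl

/-! ### Invariants of the edge data -/

/-- Only edges at distant states can be outdated, and the path of an updated edge of finite weight
is realized. -/
structure Sound (T : TransitionSystem S AP) (B : Buchi Q AP) (g : EdgeData S Q) : Prop where
  updated_of_not_distant : ∀ e, ¬ B.Distant e.1.2 → g.updated e
  realized : ∀ e, RedEdge T B e.1 e.2 → g.updated e → g.wt e < ⊤ → Realized T B g e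

/-- The edge data `g'` retains all updated edges of `g`. -/
def Extends (g g' : EdgeData S Q) : Prop :=
  ∀ e, g.updated e → g'.updated e ∧ g'.wt e = g.wt e ∧ g'.path e = g.path e

theorem Extends.refl (g : EdgeData S Q) : Extends g g := fun _ h => ⟨h, rfl, rfl⟩

theorem Extends.trans {g₁ g₂ g₃ : EdgeData S Q} (h : Extends g₁ g₂) (h' : Extends g₂ g₃) :
    Extends g₁ g₃ := fun e he =>
  ⟨(h' e (h e he).1).1, (h' e (h e he).1).2.1.trans (h e he).2.1,
    (h' e (h e he).1).2.2.trans (h e he).2.2⟩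

theorem Extends.realized {g g' : EdgeData S Q} (h : Extends g g') {e : (S × Q) × (S × Q)}
    (he : g.updated e) (hr : Realized T B g e) : Realized T B g' e := by
  rw [Realized, (h e he).2.2]
  exact hr

theorem sound_initData (T : TransitionSystem S AP) (B : Buchi Q AP) (h : S → S → ℕ) :
    Sound T B (initData T B h) where
  updated_of_not_distant e he := he
  realized e hE hu _ := by
    have hd : ¬ B.Distant e.1.2 := hu
    rcases hE with ⟨h, -⟩ | ⟨-, hE, hs⟩
    · exact absurd h hd
    · exact ⟨[e.2], by simp, isPath_cons.2 ⟨⟨hE, hs⟩, isPath_nil.2 rfl⟩, by simp [initData, hd]⟩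

theorem extends_set {g : EdgeData S Q} {e : (S × Q) × (S × Q)} (he : ¬ g.updated e) (d : ℕ∞)
    (p : List S) : Extends g (g.set e d p) := by
  intro e' he'
  have hne : e' ≠ e := by
    rintro rfl
    exact he he'
  exact ⟨Or.inr he', by simp [EdgeData.set, hne], by simp [EdgeData.set, hne]⟩

theorem Sound.set {g : EdgeData S Q} (hg : Sound T B g) (e : (S × Q) × (S × Q)) (d : ℕ∞)
    (p : List S)
    (hp : RedEdge T B e.1 e.2 → d < ⊤ →
      ∃ l, l ≠ [] ∧ IsPath (ProdEdge T B) e.1 l e.2 ∧ l.map Prod.fst = p) :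
    Sound T B (g.set e d p) where
  updated_of_not_distant e' he' := Or.inr (hg.updated_of_not_distant e' he')
  realized e' hE hu hw := by
    by_cases heq : e' = e
    · subst heq
      simpa [Realized, EdgeData.set] using hp hE (by simpa [EdgeData.set] using hw)
    · simpa [Realized, EdgeData.set, heq] using
        hg.realized e' hE (hu.resolve_left heq) (by simpa [EdgeData.set, heq] using hw)

/-- An edge still to be updated leaves a distant state, which has a negative loop; so skipped edges
are already updated. -/
theorem Sound.updated_of_not_outdated {g : EdgeData S Q} (hg : Sound T B g)
    {e : (S × Q) × (S × Q)} (he : ¬ (B.NegLoop e.1.2 ∧ ¬ g.updated e)) : g.updated e := by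
  by_contra hu
  exact hu (hg.updated_of_not_distant e fun hd => he ⟨hd.1, hu⟩)

theorem Sound.exists_prod_path_of_search {g : EdgeData S Q} (hg : Sound T B g)
    {e : (S × Q) × (S × Q)} (he : ¬ g.updated e) {c : Cond AP}
    (hl : (e.1.2, c, e.1.2) ∈ B.trans) {p : List S}
    (hp : AvoidPath T (obstacles T c) e.1.1 e.2.1 p) (hE : RedEdge T B e.1 e.2) :
    ∃ l, l ≠ [] ∧ IsPath (ProdEdge T B) e.1 l e.2 ∧ l.map Prod.fst = p := by
  rcases hE with ⟨-, c', -, hc', hs⟩ | ⟨hd, -⟩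
  -- Cells violating `c` are obstacles, so each intermediate cell enables the loop.
  · refine exists_prod_path_of_self_loop ⟨c', hc', hs⟩ hp.1 hp.2.1 fun x hx => ⟨c, hl, ?_⟩
    by_contra hx'
    exact hp.2.2 x hx (Or.inr hx')
  · exact absurd (hg.updated_of_not_distant e hd) he

/-! ### Preservation of the invariants by the searches -/

theorem UpdateEdges.sound {g g' : EdgeData S Q} {es : List ((S × Q) × (S × Q))} {n : ℕ}
    (hu : UpdateEdges T B g es g' n) (hg : Sound T B g) :
    Sound T B g' ∧ Extends g g' ∧ ∀ e ∈ es, g'.updated e := by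
  induction hu with
  | nil g => exact ⟨hg, Extends.refl g, by simp⟩
  | skip he _ ih =>
    obtain ⟨hs, hx, hm⟩ := ih hg
    exact ⟨hs, hx, List.forall_mem_cons.2 ⟨(hx _ (hg.updated_of_not_outdated he)).1, hm⟩⟩
  | found c p _ hl he hp _ ih =>
    obtain ⟨hs, hx, hm⟩ := ih (hg.set _ _ _ fun hE _ => hg.exists_prod_path_of_search he hl hp.1 hE)
    exact ⟨hs, (extends_set he _ _).trans hx,
      List.forall_mem_cons.2 ⟨(hx _ (Or.inl rfl)).1, hm⟩⟩
  | blocked c _ _ he _ _ ih =>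
    -- A blocked edge gets weight `⊤`, so nothing has to be realized.
    obtain ⟨hs, hx, hm⟩ := ih (hg.set _ _ _ fun _ h => absurd h (lt_irrefl _))
    exact ⟨hs, (extends_set he _ _).trans hx,
      List.forall_mem_cons.2 ⟨(hx _ (Or.inl rfl)).1, hm⟩⟩

theorem UpdateEdges.eq_of_zero {g g' : EdgeData S Q} {es : List ((S × Q) × (S × Q))} {n : ℕ}
    (hu : UpdateEdges T B g es g' n) (hn : n = 0) : g' = g := by
  induction hu with
  | nil g => rfl
  | skip _ _ ih => exact ih hn
  | found => omega
  | blocked => omega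

theorem wt_lt_top_of_cost {g : EdgeData S Q} {x : S × Q} {l : List (S × Q)}
    (h : g.cost x l < ⊤) {e : (S × Q) × (S × Q)} (he : e ∈ edges x l) : g.wt e < ⊤ :=
  (List.single_le_sum (fun _ _ => zero_le) _ (List.mem_map_of_mem he)).trans_lt h

/-- `x :: l` is a path to `y` in the reduced graph all of whose edges are updated and realized. -/
def RealizedPath (T : TransitionSystem S AP) (B : Buchi Q AP) (g : EdgeData S Q) (x : S × Q)
    (l : List (S × Q)) (y : S × Q) : Prop :=
  IsPath (RedEdge T B) x l y ∧ ∀ e ∈ edges x l, g.updated e ∧ Realized T B g e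

theorem RealizedPath.mono {g g' : EdgeData S Q} (hx : Extends g g') {x y : S × Q}
    {l : List (S × Q)} (h : RealizedPath T B g x l y) : RealizedPath T B g' x l y :=
  ⟨h.1, fun e he => ⟨(hx e (h.2 e he).1).1, hx.realized (h.2 e he).1 (h.2 e he).2⟩⟩

theorem Sound.realizedPath {g : EdgeData S Q} (hg : Sound T B g) {x y : S × Q}
    {l : List (S × Q)} (hl : IsPath (RedEdge T B) x l y) (hu : ∀ e ∈ edges x l, g.updated e)
    (hc : g.cost x l < ⊤) : RealizedPath T B g x l y :=
  ⟨hl, fun e he => ⟨hu e he, hg.realized e (hl.1 e he) (hu e he) (wt_lt_top_of_cost hc he)⟩⟩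

theorem SuffixSearch.sound {f : S × Q} {g g' : EdgeData S Q} {o : Option (List (S × Q))}
    (hs : SuffixSearch T B f g g' o) (hg : Sound T B g) :
    Sound T B g' ∧ Extends g g' ∧ ∀ l, o = some l → l ≠ [] ∧ RealizedPath T B g' f l f := by
  induction hs with
  | fail => exact ⟨hg, Extends.refl _, by simp⟩
  | done hl hu =>
    obtain ⟨hs, hx, hm⟩ := hu.sound hg
    refine ⟨hs, hx, ?_⟩
    rintro _ ⟨⟩
    refine ⟨hl.1, hs.realizedPath hl.2.1 hm ?_⟩
    -- No edge changed in the last round, so the finite cost found by Dijkstra's algorithm is the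
    -- cost in the returned data.
    rw [hu.eq_of_zero rfl]
    exact hl.2.2.1
  | again _ hu _ ih =>
    obtain ⟨hs, hx, -⟩ := hu.sound hg
    obtain ⟨hs', hx', hr⟩ := ih hs
    exact ⟨hs', hx.trans hx', hr⟩

theorem PrefixSearch.sound {v₀ f : S × Q} {g g' : EdgeData S Q} {o : Option (List (S × Q))}
    (hs : PrefixSearch T B v₀ f g g' o) (hg : Sound T B g) :
    Sound T B g' ∧ Extends g g' ∧ ∀ l, o = some l → RealizedPath T B g' v₀ l f := by
  cases hs with
  | fail => exact ⟨hg, Extends.refl _, by simp⟩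
  | valid hl hu hv =>
    obtain ⟨hs, hx, hm⟩ := hu.sound hg
    refine ⟨hs, hx, ?_⟩
    rintro _ ⟨⟩
    exact hs.realizedPath hl.1 hm hv
  | invalid _ hu _ => exact ⟨(hu.sound hg).1, (hu.sound hg).2.1, by simp⟩

theorem MainLoop.sound {v₀ : S × Q} {g g' : EdgeData S Q} {fs : List (S × Q)}
    {rs : List ((S × Q) × List (S × Q) × List (S × Q))}
    (hm : MainLoop T B v₀ g fs g' rs) (hg : Sound T B g) :
    Extends g g' ∧ ∀ r ∈ rs, r.1 ∈ fs ∧ r.2.1 ≠ [] ∧ RealizedPath T B g' r.1 r.2.1 r.1 ∧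
      RealizedPath T B g' v₀ r.2.2 r.1 := by
  induction hm with
  | nil g => exact ⟨Extends.refl g, by simp⟩
  | keep hs hp _ ih =>
    obtain ⟨hs₁, hx₁, hr₁⟩ := hs.sound hg
    obtain ⟨hs₂, hx₂, hr₂⟩ := hp.sound hs₁
    obtain ⟨hx₃, hr₃⟩ := ih hs₂
    refine ⟨hx₁.trans (hx₂.trans hx₃), List.forall_mem_cons.2 ⟨?_, ?_⟩⟩
    · exact ⟨List.mem_cons_self, (hr₁ _ rfl).1, (hr₁ _ rfl).2.mono (hx₂.trans hx₃),
        (hr₂ _ rfl).mono hx₃⟩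
    · exact fun r hr => ⟨List.mem_cons_of_mem _ (hr₃ r hr).1, (hr₃ r hr).2⟩
  | drop hs hp _ _ ih =>
    obtain ⟨hs₁, hx₁, -⟩ := hs.sound hg
    obtain ⟨hs₂, hx₂, -⟩ := hp.sound hs₁
    obtain ⟨hx₃, hr₃⟩ := ih hs₂
    exact ⟨hx₁.trans (hx₂.trans hx₃),
      fun r hr => ⟨List.mem_cons_of_mem _ (hr₃ r hr).1, (hr₃ r hr).2⟩⟩

/-- Every output of T* is the projection of a lasso in the product automaton, whose cycle starts
at a final state. -/
theorem Output.exists_prod_lasso {h : S → S → ℕ} {v₀ : S × Q} {pre suf : List S}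
    (hout : Output T B h v₀ pre suf) :
    ∃ (f : S × Q) (P C : List (S × Q)), f.2 ∈ B.final ∧ C ≠ [] ∧
      IsPath (ProdEdge T B) v₀ P f ∧ IsPath (ProdEdge T B) f C f ∧
      pre = (v₀ :: P).map Prod.fst ∧ suf = C.map Prod.fst := by
  obtain ⟨fs, g, rs, -, hfs, hm, r, hr, -, rfl, rfl⟩ := hout
  obtain ⟨hf, hne, hs, hp⟩ := (hm.sound (sound_initData T B h)).2 r hr
  obtain ⟨P, hP, hPm, -⟩ := exists_prod_path_of_realized hp.1 fun e he => (hp.2 e he).2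
  obtain ⟨C, hC, hCm, hCne⟩ := exists_prod_path_of_realized hs.1 fun e he => (hs.2 e he).2
  exact ⟨r.1, P, C, ((hfs r.1).1 hf).2, hCne hne, hP, hC, by simp [hPm], hCm.symm⟩

end Algorithm

/-! ### Acceptance along the product lasso -/

theorem Buchi.Accepts.cons {AP Q : Type*} {B : Buchi Q AP} {σ : ℕ → Set AP} {r : ℕ → Q}
    (h₀ : B.Step B.init (σ 0) (r 0)) (hr : ∀ n, B.Step (r n) (σ (n + 1)) (r (n + 1)))
    (hf : ∀ n, ∃ m, n ≤ m ∧ r m ∈ B.final) : B.Accepts σ := by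
  refine ⟨fun n => Nat.casesOn n B.init r, rfl, ?_, fun n => ?_⟩
  · rintro (_ | n)
    · exact h₀
    · exact hr n
  · obtain ⟨m, hm, hmf⟩ := hf n
    exact ⟨m + 1, by omega, hmf⟩

end TStar

theorem mainTheorem1 {S AP Q : Type*} [Finite S] [Finite Q]
    (T : TStar.TransitionSystem S AP) (φ : TStar.LTL AP) (B : TStar.Buchi Q AP)
    (hB : B.Recognizes φ) (h : S → S → ℕ) (q : Q) (pre suf : List S)
    (hout : TStar.Output T B h (T.init, q) pre suf)
    (ρ : ℕ → S) (hρ : ρ = TStar.lasso T.init pre suf) :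
    suf ≠ [] ∧ T.IsRun ρ ∧ (∀ n, ρ n ∉ T.obs) ∧
    (q = B.init →
      TStar.LTL.Sat (fun n => T.trace ρ (n + 1)) φ ∧
      ((∀ σ : ℕ → Set AP,
          TStar.LTL.Sat σ φ → TStar.LTL.Sat (TStar.consWord (T.L T.init) σ) φ) →
        TStar.LTL.Sat (T.trace ρ) φ)) ∧
    (B.Step B.init (T.L T.init) q → TStar.LTL.Sat (T.trace ρ) φ) := by
  obtain ⟨f, P, C, hfin, hne, hP, hC, rfl, rfl⟩ := hout.exists_prod_lasso
  obtain ⟨R, hR⟩ : ∃ R, R = TStar.lasso (T.init, q) ((T.init, q) :: P) C := ⟨_, rfl⟩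
  have hfst (n : ℕ) : ρ n = (R n).1 := by
    rw [hρ, hR, TStar.map_lasso Prod.fst]
  have hR₀ : R 0 = (T.init, q) := by rw [hR, TStar.lasso_zero]
  have hstep (n : ℕ) : TStar.ProdEdge T B (R n) (R (n + 1)) := by
    rw [hR]
    exact TStar.lasso_rel _ hP hC hne n
  have hinf (n : ℕ) : ∃ m, n ≤ m ∧ (R m).2 ∈ B.final := by
    -- The time of the `n`-th return to `f`, at least `n` because the cycle is nonempty.
    refine ⟨P.length + n * C.length, ?_, ?_⟩
    · have := Nat.le_mul_of_pos_right n (List.length_pos_iff.2 hne)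
      omega
    · rw [hR, TStar.lasso_prefix_length_add_mul _ hP hC hne]
      exact hfin
  have hE (n : ℕ) : T.E (ρ n) (ρ (n + 1)) := by
    rw [hfst, hfst]
    exact (hstep n).1
  have hB' (n : ℕ) : B.Step (R n).2 (T.trace ρ (n + 1)) (R (n + 1)).2 := by
    rw [TStar.TransitionSystem.trace, hfst]
    exact (hstep n).2
  have hρ₀ : ρ 0 = T.init := by rw [hfst, hR₀]
  -- Every cell of the run has an outgoing transition, hence is no obstacle.
  refine ⟨by simpa using hne, ⟨hρ₀, hE⟩, fun n => (T.E_free _ _ (hE n)).1, fun hq => ?_,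
    fun hq => ?_⟩
  · have hsat : TStar.LTL.Sat (fun n => T.trace ρ (n + 1)) φ :=
      (hB _).1 ⟨fun n => (R n).2, by simp [hR₀, hq], hB', hinf⟩
    refine ⟨hsat, fun hcons => ?_⟩
    have heq : T.trace ρ = TStar.consWord (T.L T.init) fun n => T.trace ρ (n + 1) := by
      funext n
      cases n with
      | zero => simp [TStar.TransitionSystem.trace, TStar.consWord, hρ₀]
      | succ n => rfl
    rw [heq]
    exact hcons _ hsat
  · refine (hB _).1 (TStar.Buchi.Accepts.cons (r := fun n => (R n).2) ?_ hB' hinf)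
    simpa [TStar.TransitionSystem.trace, hρ₀, hR₀] using hq
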